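/- Let $d$ be a non-negative integer, let $\mathscr{H}_{d+1}=\mathbb{C}^{d+1}$, let $K\subset\mathscr{H}_{d+1}$ be any $d$-dimensional subspace, and let $P$ be the orthogonal projection onto $K$. Write $\mathfrak{u}(K)\cong\mathfrak{u}(d)$ for the real Lie algebra of skew-adjoint operators on $K$ (the operators $ih$ with $h$ self-adjoint, with the commutator as bracket); for self-adjoint $h_1,\ldots,h_m$ on $K$ let $\mathfrak{Lie}(h_1,\ldots,h_m)$ be the real Lie algebra generated by $ih_1,\ldots,ih_m$. (1) For almost all pairs $(H_1,H_2)$ of commuting self-adjoint operators on $\mathscr{H}_{d+1}$, the compressions $h_1=PH_1P$ and $h_2=PH_2P$, regarded as operators on $K$, satisfy $\mathfrak{Lie}(h_1,h_2)=\mathfrak{u}(K)$. Here "almost all" refers to the joint diagonalization $H_1=UD_1U^\dagger$, $H_2=UD_2U^\dagger$, with $U\in\mathcal{U}(d+1)$ and $D_1,D_2$ real diagonal: the set of parameters $(U,D_1,D_2)$ for which the property fails is a null set for the product of Haar measure on $\mathcal{U}(d+1)$ and Lebesgue measure on $\mathbb{R}^{d+1}\times\mathbb{R}^{d+1}$. (2)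 Consequently some maximal commutative Lie subalgebra $\mathfrak{A}$ of $\mathfrak{u}(d+1)$ provides a generator purification of $\mathfrak{u}(K)$: there are finitely many self-adjoint operators $H_1,\ldots,H_m$ on $\mathscr{H}_{d+1}$, pairwise commuting, with $iH_j\in\mathfrak{A}$ for all $j$, whose compressions $h_j=PH_jP$ to $K$ satisfy $\mathfrak{Lie}(h_1,\ldots,h_m)=\mathfrak{u}(K)$. -/

import Mathlib

open MeasureTheory Matrix

attribute [local instance 100] LieRing.ofAssociativeRing

/-- The Lie algebra `𝔲(E)` of a finite-dimensional complex Hilbert space `E`: the real Lie algebra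
of all skew-adjoint operators on `E`, i.e. of the operators `i h` with `h` self-adjoint. The bracket
is the commutator. -/
noncomputable def unitaryLieAlgebra (E : Type*) [NormedAddCommGroup E] [InnerProductSpace ℂ E]
    [FiniteDimensional ℂ E] : LieSubalgebra ℝ (Module.End ℂ E) where
  carrier := {X | star X = -X}
  zero_mem' := by simp
  add_mem' := by
    intro a b ha hb
    simp only [Set.mem_ofPred_eq] at *
    rw [star_add, ha, hb, neg_add]
  smul_mem' := by
    intro c x hx
    simp only [Set.mem_ofPred_eq] at *
    have h : c • x = (c : ℂ) • x := rfl
    rw [h, star_smul, hx, smul_neg]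
    simp
  lie_mem' := by
    intro a b ha hb
    simp only [Set.mem_ofPred_eq] at *
    change star (a * b - b * a) = -(a * b - b * a)
    rw [star_sub, star_mul, star_mul, ha, hb]
    simp

/-- The compression of an operator `H` on `E` to a subspace `K`: the operator `P H P` regarded as an
operator on `K`, where `P` is the orthogonal projection onto `K`. -/
noncomputable def compression {E : Type*} [NormedAddCommGroup E] [InnerProductSpace ℂ E]
    [FiniteDimensional ℂ E] (K : Submodule ℂ E) (H : Module.End ℂ E) : Module.End ℂ K :=
  K.orthogonalProjectionOnto.toLinearMap ∘ₗ H ∘ₗ K.subtype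

/-- The real Lie algebra generated by a family of Hamiltonians `h j`, i.e. by the skew-adjoint
operators `i h j`. -/
noncomputable def lieGenerated {E : Type*} [AddCommGroup E] [Module ℂ E] {ι : Type*}
    (h : ι → Module.End ℂ E) : LieSubalgebra ℝ (Module.End ℂ E) :=
  LieSubalgebra.lieSpan ℝ (Module.End ℂ E) (Set.range fun j => Complex.I • h j)

/-- The Hamiltonians `H j` on `E` purify the Hamiltonians `h j` on the subspace `K`: they commute
pairwise, and `h j` is the compression of `H j`. -/
structure IsHamiltonianPurification {E : Type*} [NormedAddCommGroup E] [InnerProductSpace ℂ E]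
    [FiniteDimensional ℂ E] (K : Submodule ℂ E) {ι : Type*} (h : ι → Module.End ℂ K)
    (H : ι → Module.End ℂ E) : Prop where
  isSelfAdjoint_small : ∀ j, IsSelfAdjoint (h j)
  isSelfAdjoint_ext : ∀ j, IsSelfAdjoint (H j)
  commute : ∀ j k, Commute (H j) (H k)
  eq_compression : ∀ j, h j = compression K (H j)

/-- The commutative Lie algebra `A` of Hamiltonians on `E` provides a generator purification of
the Lie algebra `a` of Hamiltonians on the subspace `K`: some finite generating family of `a` has a
Hamiltonian purification in `A`. A Hamiltonian `H` corresponds to the element `i H`. -/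
structure IsGeneratorPurification {E : Type*} [NormedAddCommGroup E] [InnerProductSpace ℂ E]
    [FiniteDimensional ℂ E] (K : Submodule ℂ E) (A : LieSubalgebra ℝ (Module.End ℂ E))
    (a : LieSubalgebra ℝ (Module.End ℂ K)) : Prop where
  le_unitary : A ≤ unitaryLieAlgebra E
  isLieAbelian : IsLieAbelian A
  exists_purification : ∃ (m : ℕ) (h : Fin m → Module.End ℂ K) (H : Fin m → Module.End ℂ E),
    IsHamiltonianPurification K h H ∧ (∀ j, Complex.I • H j ∈ A) ∧ lieGenerated h = a

/-- `A` is a largest commutative Lie algebra of Hamiltonians on `E`. -/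
def IsMaximalCommutative {E : Type*} [NormedAddCommGroup E] [InnerProductSpace ℂ E]
    [FiniteDimensional ℂ E] (A : LieSubalgebra ℝ (Module.End ℂ E)) : Prop :=
  Maximal (fun B : LieSubalgebra ℝ (Module.End ℂ E) => B ≤ unitaryLieAlgebra E ∧ IsLieAbelian B) A

/-- The pairs `(H₁, H₂)` of commuting Hamiltonians on `ℂⁿ`. -/
def CommutingPair (n : ℕ) : Type :=
  {p : Module.End ℂ (EuclideanSpace ℂ (Fin n)) × Module.End ℂ (EuclideanSpace ℂ (Fin n)) //
    IsSelfAdjoint p.1 ∧ IsSelfAdjoint p.2 ∧ Commute p.1 p.2}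

/-- The operator `U diag(x) U†` on `ℂⁿ`. -/
noncomputable def diagonalized {n : ℕ} (U : Matrix.unitaryGroup (Fin n) ℂ) (x : Fin n → ℝ) :
    Module.End ℂ (EuclideanSpace ℂ (Fin n)) :=
  Matrix.toEuclideanLin
    ((U : Matrix (Fin n) (Fin n) ℂ) * diagonal (fun i => (x i : ℂ)) *
      (U : Matrix (Fin n) (Fin n) ℂ)ᴴ)

theorem isSelfAdjoint_diagonalized {n : ℕ} (U : Matrix.unitaryGroup (Fin n) ℂ) (x : Fin n → ℝ) :
    IsSelfAdjoint (diagonalized U x) := by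
  have h : (diagonal (fun i => (x i : ℂ)))ᴴ = diagonal (fun i => (x i : ℂ)) := by
    rw [diagonal_conjTranspose]
    congr 1
    funext i
    simp
  rw [isSelfAdjoint_iff, LinearMap.star_eq_adjoint, diagonalized,
    ← Matrix.toEuclideanLin_conjTranspose_eq_adjoint]
  simp [Matrix.mul_assoc, h]

theorem commute_diagonalized {n : ℕ} (U : Matrix.unitaryGroup (Fin n) ℂ) (x y : Fin n → ℝ) :
    Commute (diagonalized U x) (diagonalized U y) := by
  have hU : (U : Matrix (Fin n) (Fin n) ℂ)ᴴ * (U : Matrix (Fin n) (Fin n) ℂ) = 1 :=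
    (Matrix.mem_unitaryGroup_iff').1 U.2
  have key : ∀ a b : Fin n → ℝ, diagonalized U a * diagonalized U b =
      diagonalized U (fun i => a i * b i) := by
    intro a b
    unfold diagonalized
    rw [Module.End.mul_eq_comp, ← Matrix.toLpLin_mul_same]
    congr 1
    calc _ = (U : Matrix (Fin n) (Fin n) ℂ) * diagonal (fun i => (a i : ℂ)) *
          ((U : Matrix (Fin n) (Fin n) ℂ)ᴴ * (U : Matrix (Fin n) (Fin n) ℂ)) *
          diagonal (fun i => (b i : ℂ)) * (U : Matrix (Fin n) (Fin n) ℂ)ᴴ := by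
            simp only [Matrix.mul_assoc]
      _ = _ := by
            rw [hU, Matrix.mul_one, Matrix.mul_assoc _ (diagonal _) (diagonal _),
              diagonal_mul_diagonal]
            simp
  rw [Commute, SemiconjBy, key, key]
  simp only [mul_comm]

/-- The parametrization of the commuting pairs by their joint diagonalization:
`(U, x, y)` is sent to `(U diag(x) U†, U diag(y) U†)`. By the spectral theorem every commuting
pair of Hamiltonians arises in this way. -/
noncomputable def commutingPair (n : ℕ)
    (q : Matrix.unitaryGroup (Fin n) ℂ × (Fin n → ℝ) × (Fin n → ℝ)) : CommutingPair n :=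
  ⟨(diagonalized q.1 q.2.1, diagonalized q.1 q.2.2), isSelfAdjoint_diagonalized _ _,
    isSelfAdjoint_diagonalized _ _, commute_diagonalized _ _ _⟩

instance unitaryGroupCompactSpace (n : ℕ) : CompactSpace (Matrix.unitaryGroup (Fin n) ℂ) := by
  suffices h : IsCompact
      ((Matrix.unitaryGroup (Fin n) ℂ : Submonoid _) : Set (Matrix (Fin n) (Fin n) ℂ)) from
    isCompact_iff_compactSpace.1 h
  have hc : IsCompact {A : Matrix (Fin n) (Fin n) ℂ | ∀ i, A i ∈
      {v : Fin n → ℂ | ∀ j, v j ∈ Metric.closedBall (0 : ℂ) 1}} :=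
    isCompact_pi_infinite fun _ => isCompact_pi_infinite fun _ => isCompact_closedBall _ _
  refine hc.of_isClosed_subset ?_ ?_
  · have : ((Matrix.unitaryGroup (Fin n) ℂ : Submonoid _) : Set (Matrix (Fin n) (Fin n) ℂ)) =
        {A | A * star A = 1} := by
      ext A
      exact Matrix.mem_unitaryGroup_iff
    rw [this]
    exact isClosed_eq (by fun_prop) continuous_const
  · intro A hA i j
    simpa using entry_norm_bound_of_unitary hA i j

noncomputable instance unitaryGroupMeasurableSpace (n : ℕ) :
    MeasurableSpace (Matrix.unitaryGroup (Fin n) ℂ) := borel _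

instance unitaryGroupBorelSpace (n : ℕ) : BorelSpace (Matrix.unitaryGroup (Fin n) ℂ) := ⟨rfl⟩

/-- The reference measure on the parameters `(U, x, y)`: Haar measure on the unitary group and
Lebesgue measure on the two lists of eigenvalues. -/
noncomputable def parameterMeasure (n : ℕ) :
    Measure (Matrix.unitaryGroup (Fin n) ℂ × (Fin n → ℝ) × (Fin n → ℝ)) :=
  (Measure.haar : Measure (Matrix.unitaryGroup (Fin n) ℂ)).prod (volume.prod volume)

/-- `∀ᶠ p in almostAllCommutingPairs n, Q p` says that `Q` holds for almost all pairs of commuting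
Hamiltonians on `ℂⁿ`: the parameters `(U, x, y)` whose pair violates `Q` form a null set. -/
noncomputable def almostAllCommutingPairs (n : ℕ) : Filter (CommutingPair n) :=
  Filter.map (commutingPair n) (ae (parameterMeasure n))

/-! Let `v` span the line orthogonal to `K`. The key is one good pair for each `U` none of whose
columns is orthogonal to `v`: give `H₁` distinct eigenvalues and let `H₂` be the projection onto a
column `b`. The compressions are some `A` and `|u⟩⟨u|` with `u = P b`, and `u` is cyclic for `A`
(`eq_zero_of_forall_inner_pow_compression`). Brackets then produce every `|A^j u⟩⟨A^k u|`, hence all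
operators on `K` (`lieSpan_ketBra_eq_top`).

Over `ℂ`, generation means that some determinant of iterated brackets is nonzero. For fixed `U` this
determinant is polynomial in the eigenvalues, so failure is a closed set meeting each line through
the good pair in finitely many points, hence a null set. Almost every `U` is admissible
(`haar_setOf_inner_unitaryColumn_eq_zero`), and Fubini concludes. Complex generation by `h₁, h₂`
gives real generation of `𝔲(K)` by `i h₁, i h₂`, because `𝔲(K) ∩ i 𝔲(K) = 0`. For the second claim,
take one generating pair and enlarge the commutative algebra it spans to a maximal one. -/

/-! ### Iterated brackets of two elements -/

/-- The iterated bracket of `a` and `b` along a binary tree. -/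
def bracketTree {L : Type*} [Bracket L L] (a b : L) : FreeMagma Bool → L
  | .of i => if i then a else b
  | .mul s t => ⁅bracketTree a b s, bracketTree a b t⁆

theorem map_bracketTree {L M F : Type*} [Bracket L L] [Bracket M M] [FunLike F L M] (f : F)
    (hf : ∀ x y, f ⁅x, y⁆ = ⁅f x, f y⁆) (a b : L) (t : FreeMagma Bool) :
    f (bracketTree a b t) = bracketTree (f a) (f b) t := by
  induction t with
  | ih1 i => cases i <;> simp [bracketTree]
  | ih2 s t hs ht =>
    change f ⁅bracketTree a b s, bracketTree a b t⁆ = ⁅_, _⁆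
    rw [hf, hs, ht]

/-- By bilinearity the span of the iterated brackets is closed under the bracket. Generation becomes
a question of linear algebra. -/
theorem lieSpan_pair_toSubmodule {R L : Type*} [CommRing R] [LieRing L] [LieAlgebra R L] (a b : L) :
    (LieSubalgebra.lieSpan R L {a, b}).toSubmodule =
      Submodule.span R (Set.range (bracketTree a b)) := by
  apply le_antisymm
  · have hlie : ∀ x y, x ∈ Submodule.span R (Set.range (bracketTree a b)) →
        y ∈ Submodule.span R (Set.range (bracketTree a b)) →
        ⁅x, y⁆ ∈ Submodule.span R (Set.range (bracketTree a b)) := by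
      intro x y hx hy
      induction hx using Submodule.span_induction with
      | zero => simp
      | add x x' _ _ hx hx' => rw [add_lie]; exact add_mem hx hx'
      | smul r x _ hx => rw [smul_lie]; exact Submodule.smul_mem _ _ hx
      | mem x hx =>
        obtain ⟨s, rfl⟩ := hx
        induction hy using Submodule.span_induction with
        | zero => simp
        | add x x' _ _ hx hx' => rw [lie_add]; exact add_mem hx hx'
        | smul r x _ hx => rw [lie_smul]; exact Submodule.smul_mem _ _ hx
        | mem y hy =>
          obtain ⟨t, rfl⟩ := hy
          exact Submodule.subset_span ⟨.mul s t, rfl⟩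
    let S : LieSubalgebra R L :=
      { Submodule.span R (Set.range (bracketTree a b)) with
        lie_mem' := fun {x y} hx hy => hlie x y hx hy }
    change LieSubalgebra.lieSpan R L {a, b} ≤ S
    rw [LieSubalgebra.lieSpan_le]
    rintro x (rfl | rfl)
    · exact Submodule.subset_span ⟨.of true, rfl⟩
    · exact Submodule.subset_span ⟨.of false, rfl⟩
  · rw [Submodule.span_le]
    rintro _ ⟨t, rfl⟩
    induction t with
    | ih1 i =>
      apply LieSubalgebra.subset_lieSpan
      cases i <;> simp [bracketTree]
    | ih2 s t hs ht => exact LieSubalgebra.lie_mem _ hs ht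

theorem lieSpan_pair_eq_top_iff {R L : Type*} [CommRing R] [LieRing L] [LieAlgebra R L] (a b : L) :
    LieSubalgebra.lieSpan R L {a, b} = ⊤ ↔
      Submodule.span R (Set.range (bracketTree a b)) = ⊤ := by
  rw [← lieSpan_pair_toSubmodule, ← LieSubalgebra.toSubmodule_inj, LieSubalgebra.top_toSubmodule]

/-! ### Complexification of a real Lie algebra of operators -/

/-- The complex Lie algebra `S + i S` spanned by a real Lie algebra `S` of operators. -/
noncomputable def complexSpan {E : Type*} [AddCommGroup E] [Module ℂ E]
    (S : LieSubalgebra ℝ (Module.End ℂ E)) : LieSubalgebra ℂ (Module.End ℂ E) where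
  carrier := {X | ∃ a ∈ S, ∃ b ∈ S, X = a + Complex.I • b}
  zero_mem' := ⟨0, zero_mem _, 0, zero_mem _, by simp⟩
  add_mem' := by
    rintro _ _ ⟨a, ha, b, hb, rfl⟩ ⟨a', ha', b', hb', rfl⟩
    exact ⟨a + a', add_mem ha ha', b + b', add_mem hb hb', by rw [smul_add]; abel⟩
  smul_mem' := by
    rintro c _ ⟨a, ha, b, hb, rfl⟩
    refine ⟨c.re • a - c.im • b, sub_mem (S.smul_mem _ ha) (S.smul_mem _ hb),
      c.im • a + c.re • b, add_mem (S.smul_mem _ ha) (S.smul_mem _ hb), ?_⟩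
    have h (r : ℝ) (X : Module.End ℂ E) : r • X = (r : ℂ) • X := rfl
    simp only [h]
    nth_rw 1 [← Complex.re_add_im c]
    match_scalars <;> ring_nf
    rw [Complex.I_sq]
    ring
  lie_mem' := by
    rintro _ _ ⟨a, ha, b, hb, rfl⟩ ⟨a', ha', b', hb', rfl⟩
    refine ⟨⁅a, a'⁆ - ⁅b, b'⁆, sub_mem (S.lie_mem ha ha') (S.lie_mem hb hb'),
      ⁅a, b'⁆ + ⁅b, a'⁆, add_mem (S.lie_mem ha hb') (S.lie_mem hb ha'), ?_⟩
    change (a + Complex.I • b) * (a' + Complex.I • b') - (a' + Complex.I • b') * (a + Complex.I • b)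
      = ((a * a' - a' * a) - (b * b' - b' * b)) +
        Complex.I • ((a * b' - b' * a) + (b * a' - a' * b))
    simp only [add_mul, mul_add, smul_mul_assoc, mul_smul_comm, smul_add, smul_sub, smul_smul,
      Complex.I_mul_I, neg_smul, one_smul]
    abel

/-! ### Rank-one operators and cyclic vectors -/

section
variable {E : Type*} [NormedAddCommGroup E] [InnerProductSpace ℂ E]

/-- The operator `|x⟩⟨y|`. -/
noncomputable def ketBra (x y : E) : Module.End ℂ E := (InnerProductSpace.rankOne ℂ x y).toLinearMap

@[simp] theorem ketBra_apply (x y z : E) : ketBra x y z = inner ℂ y z • x := rfl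

theorem ketBra_lie_ketBra (x y z w : E) :
    ⁅ketBra x y, ketBra z w⁆ = inner ℂ y z • ketBra x w - inner ℂ w x • ketBra z y := by
  change ketBra x y * ketBra z w - ketBra z w * ketBra x y = _
  ext t
  simp [smul_smul, mul_comm]

variable [FiniteDimensional ℂ E]

theorem mem_unitaryLieAlgebra {X : Module.End ℂ E} : X ∈ unitaryLieAlgebra E ↔ star X = -X :=
  Iff.rfl

theorem I_smul_mem_unitaryLieAlgebra {h : Module.End ℂ E} (hh : IsSelfAdjoint h) :
    Complex.I • h ∈ unitaryLieAlgebra E := by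
  rw [mem_unitaryLieAlgebra, star_smul, hh.star_eq]
  simp

/-- If `S` is the real algebra, `S + i S` contains both `h`'s, hence everything. A skew-adjoint `X =
a + i b` with `a, b ∈ S` skew-adjoint has `i b` both self-adjoint and skew-adjoint, so `X = a`. -/
theorem lieGenerated_pair_eq_unitaryLieAlgebra {h₁ h₂ : Module.End ℂ E} (hh₁ : IsSelfAdjoint h₁)
    (hh₂ : IsSelfAdjoint h₂) (h : LieSubalgebra.lieSpan ℂ (Module.End ℂ E) {h₁, h₂} = ⊤) :
    lieGenerated ![h₁, h₂] = unitaryLieAlgebra E := by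
  have hle : lieGenerated ![h₁, h₂] ≤ unitaryLieAlgebra E := by
    refine LieSubalgebra.lieSpan_le.2 ?_
    rintro _ ⟨j, rfl⟩
    fin_cases j
    · exact I_smul_mem_unitaryLieAlgebra hh₁
    · exact I_smul_mem_unitaryLieAlgebra hh₂
  have hgen (j : Fin 2) : Complex.I • ![h₁, h₂] j ∈ lieGenerated ![h₁, h₂] :=
    LieSubalgebra.subset_lieSpan ⟨j, rfl⟩
  have hmem (j : Fin 2) : ![h₁, h₂] j ∈ complexSpan (lieGenerated ![h₁, h₂]) :=
    ⟨0, zero_mem _, _, neg_mem (hgen j), by simp [smul_smul]⟩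
  have htop : (⊤ : LieSubalgebra ℂ (Module.End ℂ E)) ≤ complexSpan (lieGenerated ![h₁, h₂]) := by
    rw [← h, LieSubalgebra.lieSpan_le]
    rintro _ (rfl | rfl)
    · exact hmem 0
    · exact hmem 1
  refine le_antisymm hle fun X hX => ?_
  obtain ⟨a, ha, b, hb, hab⟩ := htop (LieSubalgebra.mem_top X)
  have ha' := mem_unitaryLieAlgebra.1 (hle ha)
  have hb' := mem_unitaryLieAlgebra.1 (hle hb)
  have hX' := mem_unitaryLieAlgebra.1 hX
  rw [hab, star_add, star_smul, ha', hb'] at hX'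
  simp only [RCLike.star_def, Complex.conj_I, smul_neg, neg_smul, neg_neg, neg_add] at hX'
  have h0 : Complex.I • b = 0 := by
    have h := add_left_cancel hX'
    have h2 : (2 : ℂ) • (Complex.I • b) = 0 := by
      rw [two_smul]
      nth_rw 1 [h]
      exact neg_add_cancel _
    exact (smul_eq_zero.1 h2).resolve_left two_ne_zero
  rw [hab, h0, add_zero]
  exact ha

theorem lie_ketBra {A : Module.End ℂ E} (hA : IsSelfAdjoint A) (x y : E) :
    ⁅A, ketBra x y⁆ = ketBra (A x) y - ketBra x (A y) := by
  have h := (LinearMap.isSymmetric_iff_isSelfAdjoint A).2 hA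
  change A * ketBra x y - ketBra x y * A = _
  ext z
  simp [h y z]

theorem ketBra_pow_mem {L : LieSubalgebra ℂ (Module.End ℂ E)} {A : Module.End ℂ E}
    (hA : IsSelfAdjoint A) (hAL : A ∈ L) {u : E} (hu : u ≠ 0) (huL : ketBra u u ∈ L) (j k : ℕ) :
    ketBra ((A ^ j) u) ((A ^ k) u) ∈ L := by
  have hc : (inner ℂ u u : ℂ) ≠ 0 := inner_self_ne_zero.2 hu
  have hdiv {X : Module.End ℂ E} {c : ℂ} (hc : c ≠ 0) (h : c • X ∈ L) : X ∈ L := by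
    simpa [smul_smul, hc] using L.smul_mem c⁻¹ h
  have hD := L.lie_mem hAL huL
  rw [lie_ketBra hA] at hD
  -- Bracketing `|u⟩⟨u|` with the difference `|Au⟩⟨u| - |u⟩⟨Au|` gives, modulo `|u⟩⟨u|`, a multiple
  -- of the sum; sum and difference separate the two terms.
  have hS : ketBra (A u) u + ketBra u (A u) ∈ L := by
    have h := L.lie_mem huL hD
    rw [lie_sub, ketBra_lie_ketBra, ketBra_lie_ketBra] at h
    refine hdiv hc ?_
    have h' := L.sub_mem (add_mem (L.smul_mem (inner ℂ u (A u)) huL)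
      (L.smul_mem (inner ℂ (A u) u) huL)) h
    convert h' using 1
    module
  have h10 : ketBra (A u) u ∈ L := by
    refine hdiv two_ne_zero ?_
    convert add_mem hS hD using 1
    module
  have h01 : ketBra u (A u) ∈ L := by
    convert sub_mem hS h10 using 1
    module
  have key : ∀ k : ℕ, ketBra ((A ^ k) u) u ∈ L ∧ ketBra u ((A ^ k) u) ∈ L := by
    intro k
    induction k with
    | zero => simpa using huL
    | succ k ih =>
      obtain ⟨h1, h2⟩ := ih
      have e : (A ^ (k + 1)) u = A ((A ^ k) u) := by rw [pow_succ']; rfl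
      rw [e]
      constructor
      -- This is the unwanted term of `[A, |A^k u⟩⟨u|]`; it comes from `[|A^k u⟩⟨u|, |u⟩⟨Au|]`
      -- modulo `|u⟩⟨u|`.
      · have h3 : ketBra ((A ^ k) u) (A u) ∈ L := by
          refine hdiv hc ?_
          have h := L.lie_mem h1 h01
          rw [ketBra_lie_ketBra] at h
          convert add_mem h (L.smul_mem (inner ℂ (A u) ((A ^ k) u)) huL) using 1
          module
        have h := L.lie_mem hAL h1
        rw [lie_ketBra hA] at h
        convert add_mem h h3 using 1
        module
      · have h3 : ketBra (A u) ((A ^ k) u) ∈ L := by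
          refine hdiv hc ?_
          have h := L.lie_mem h10 h2
          rw [ketBra_lie_ketBra] at h
          convert add_mem h (L.smul_mem (inner ℂ ((A ^ k) u) (A u)) huL) using 1
          module
        have h := L.lie_mem hAL h2
        rw [lie_ketBra hA] at h
        convert sub_mem h3 h using 1
        module
  refine hdiv hc ?_
  have h := L.lie_mem (key j).1 (key k).2
  rw [ketBra_lie_ketBra] at h
  convert add_mem h (L.smul_mem (inner ℂ ((A ^ k) u) ((A ^ j) u)) huL) using 1
  module

/-- The hypothesis on `u` is cyclicity: the `A^k u` span `E`, so the operators `|A^j u⟩⟨A^k u|` span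
`End E`. -/
theorem lieSpan_ketBra_eq_top {A : Module.End ℂ E} (hA : IsSelfAdjoint A) {u : E}
    (hu : ∀ w : E, (∀ k : ℕ, inner ℂ ((A ^ k) u) w = 0) → w = 0) :
    LieSubalgebra.lieSpan ℂ (Module.End ℂ E) {A, ketBra u u} = ⊤ := by
  rw [eq_top_iff]
  intro X _
  set L := LieSubalgebra.lieSpan ℂ (Module.End ℂ E) {A, ketBra u u}
  -- A zero cyclic vector forces `E = 0`; this covers `d = 0`.
  by_cases hu0 : u = 0
  · have : X = 0 := by
      ext w
      rw [hu (X w) fun k => by simp [hu0]]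
      rfl
    rw [this]
    exact zero_mem _
  have hmem := ketBra_pow_mem hA (L := L) (LieSubalgebra.subset_lieSpan (by simp)) hu0
    (LieSubalgebra.subset_lieSpan (by simp))
  have hspan : Submodule.span ℂ (Set.range fun k : ℕ => (A ^ k) u) = ⊤ := by
    rw [← Submodule.orthogonal_eq_bot_iff, eq_bot_iff]
    intro w hw
    exact hu w fun k => (Submodule.mem_orthogonal _ _).1 hw _ (Submodule.subset_span ⟨k, rfl⟩)
  have h1 (x : E) (k : ℕ) : ketBra x ((A ^ k) u) ∈ L := by
    have hx : x ∈ Submodule.span ℂ (Set.range fun k : ℕ => (A ^ k) u) := hspan ▸ Submodule.mem_top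
    induction hx using Submodule.span_induction with
    | zero => convert zero_mem L; simp [ketBra]
    | add x y _ _ hx hy => convert add_mem hx hy; ext; simp
    | smul c x _ hx => convert L.smul_mem c hx; ext; simp [smul_comm c]
    | mem x hx => obtain ⟨j, rfl⟩ := hx; exact hmem j k
  have h2 (x y : E) : ketBra x y ∈ L := by
    have hy : y ∈ Submodule.span ℂ (Set.range fun k : ℕ => (A ^ k) u) := hspan ▸ Submodule.mem_top
    induction hy using Submodule.span_induction with
    | zero => convert zero_mem L; simp [ketBra]
    | add y z _ _ hy hz => convert add_mem hy hz; ext; simp [add_smul]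
    | smul c y _ hy =>
      convert L.smul_mem (star c) hy; ext; simp [smul_smul, mul_comm]
    | mem x hx => obtain ⟨j, rfl⟩ := hx; exact h1 _ _
  let b := stdOrthonormalBasis ℂ E
  have hX : X = ∑ i, ketBra (X (b i)) (b i) := by
    ext w
    conv_lhs => rw [← b.sum_repr' w]
    simp
  rw [hX]
  exact sum_mem fun i _ => h2 _ _
end

/-! ### Compressions to a hyperplane -/

section
variable {E : Type*} [NormedAddCommGroup E] [InnerProductSpace ℂ E] [FiniteDimensional ℂ E]

theorem inner_compression (K : Submodule ℂ E) (H : Module.End ℂ E) (x y : K) :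
    inner ℂ x (compression K H y) = inner ℂ (x : E) (H y) := by
  rw [compression, LinearMap.comp_apply, LinearMap.comp_apply]
  exact (K.inner_orthogonalProjectionOnto_eq_of_mem_left x (H y))

theorem isSelfAdjoint_compression (K : Submodule ℂ E) {H : Module.End ℂ E} (hH : IsSelfAdjoint H) :
    IsSelfAdjoint (compression K H) := by
  rw [← LinearMap.isSymmetric_iff_isSelfAdjoint] at hH ⊢
  intro x y
  rw [inner_compression, ← inner_conj_symm, inner_compression, inner_conj_symm]
  exact hH _ _

theorem compression_ketBra (K : Submodule ℂ E) (x : E) :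
    compression K (ketBra x x) =
      ketBra (K.orthogonalProjectionOnto x) (K.orthogonalProjectionOnto x) := by
  ext1 w
  refine ext_inner_left ℂ fun z => ?_
  rw [inner_compression]
  simp [inner_smul_right]

/-- The orthogonal complement of the cyclic subspace of `u` is invariant under the self-adjoint `A`;
being nonzero, it contains an eigenvector. -/
theorem exists_hasEigenvector_inner_eq_zero {A : Module.End ℂ E} (hA : IsSelfAdjoint A) {u w : E}
    (hw : ∀ k : ℕ, inner ℂ ((A ^ k) u) w = 0) (hw0 : w ≠ 0) :
    ∃ (c : ℂ) (z : E), z ≠ 0 ∧ A z = c • z ∧ inner ℂ u z = 0 := by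
  have hs := (LinearMap.isSymmetric_iff_isSelfAdjoint A).2 hA
  let W : Submodule ℂ E := (Submodule.span ℂ (Set.range fun k : ℕ => (A ^ k) u))ᗮ
  have hW (z : E) : z ∈ W ↔ ∀ k : ℕ, inner ℂ ((A ^ k) u) z = 0 := by
    constructor
    · intro hz k
      exact (Submodule.mem_orthogonal _ _).1 hz _ (Submodule.subset_span ⟨k, rfl⟩)
    · intro hz
      rw [Submodule.mem_orthogonal]
      intro y hy
      induction hy using Submodule.span_induction with
      | zero => simp
      | add x y _ _ hx hy => rw [inner_add_left, hx, hy, add_zero]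
      | smul c x _ hx => rw [inner_smul_left, hx, mul_zero]
      | mem x hx => obtain ⟨k, rfl⟩ := hx; exact hz k
  have hinv : ∀ z ∈ W, A z ∈ W := by
    intro z hz
    rw [hW] at hz ⊢
    intro k
    rw [← hs, ← Module.End.mul_apply, ← pow_succ']
    exact hz _
  have : Nontrivial W := ⟨⟨w, (hW w).2 hw⟩, 0, fun h => hw0 (congrArg Subtype.val h)⟩
  obtain ⟨c, hc⟩ := Module.End.exists_eigenvalue (A.restrict hinv)
  obtain ⟨z, hz⟩ := hc.exists_hasEigenvector
  refine ⟨c, z, fun h => hz.2 (Subtype.ext h), congrArg Subtype.val hz.apply_eq_smul, ?_⟩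
  exact (hW z).1 z.2 0

/-- Otherwise the compression has an eigenvector `z ∈ K` orthogonal to `b i`, and `H z - c z = m v`.
Pairing with `b i` gives `m = 0`, so `z` is an eigenvector of `H`, a multiple of some `b j` since
the spectrum is simple. But `z ⊥ v`, while `b j` is not orthogonal to `v`. -/
theorem eq_zero_of_forall_inner_pow_compression {ι : Type*} [Fintype ι] (K : Submodule ℂ E) {v : E}
    (hv : Kᗮ = ℂ ∙ v) (b : OrthonormalBasis ι ℂ E) (hb : ∀ j, inner ℂ (b j) v ≠ 0) {x : ι → ℝ}
    (hx : Function.Injective x) {H : Module.End ℂ E} (hH : IsSelfAdjoint H)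
    (hHb : ∀ j, H (b j) = (x j : ℂ) • b j) (i : ι) (w : K)
    (hw : ∀ k : ℕ, inner ℂ ((compression K H ^ k) (K.orthogonalProjectionOnto (b i))) w = 0) :
    w = 0 := by
  by_contra hw0
  obtain ⟨c, z, hz0, hz, huz⟩ :=
    exists_hasEigenvector_inner_eq_zero (isSelfAdjoint_compression K hH) hw hw0
  have hs := (LinearMap.isSymmetric_iff_isSelfAdjoint H).2 hH
  have hi : inner ℂ (b i) (z : E) = 0 := by simpa using huz
  have hmem : H z - c • (z : E) ∈ Kᗮ := by
    rw [Submodule.mem_orthogonal]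
    intro y hy
    rw [inner_sub_right, inner_smul_right]
    have h := inner_compression K H ⟨y, hy⟩ z
    rw [hz, inner_smul_right] at h
    rw [sub_eq_zero]
    exact h.symm
  rw [hv, Submodule.mem_span_singleton] at hmem
  obtain ⟨m, hm⟩ := hmem
  have hcoord (j : ι) : m * inner ℂ (b j) v = (x j - c) * inner ℂ (b j) (z : E) := by
    have h := congrArg (fun y => inner ℂ (b j) y) hm
    simp only [inner_smul_right, inner_sub_right] at h
    rw [h, ← hs, hHb, inner_smul_left, sub_mul]
    simp
  have hm0 : m = 0 := by
    have h := hcoord i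
    rw [hi, mul_zero] at h
    exact (mul_eq_zero.1 h).resolve_right (hb i)
  have hz0' : (z : E) ≠ 0 := fun h => hz0 (Subtype.ext h)
  obtain ⟨j, hj⟩ : ∃ j, inner ℂ (b j) (z : E) ≠ 0 := by
    by_contra! h
    refine hz0' ?_
    rw [← b.sum_repr' (z : E)]
    simp [h]
  have hcj : (x j : ℂ) = c := by
    have h := hcoord j
    rw [hm0, zero_mul, eq_comm] at h
    exact sub_eq_zero.1 ((mul_eq_zero.1 h).resolve_right hj)
  have hother (l : ι) (hl : l ≠ j) : inner ℂ (b l) (z : E) = 0 := by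
    have h := hcoord l
    rw [hm0, zero_mul, eq_comm] at h
    refine (mul_eq_zero.1 h).resolve_left fun h' => hl (hx ?_)
    rw [← hcj, sub_eq_zero] at h'
    exact_mod_cast h'
  have hvz : inner ℂ (z : E) v = 0 := by
    refine (Submodule.mem_orthogonal K v).1 ?_ z z.2
    rw [hv]
    exact Submodule.mem_span_singleton_self v
  rw [← b.sum_inner_mul_inner, Finset.sum_eq_single j] at hvz
  · rcases mul_eq_zero.1 hvz with h | h
    · exact hj (inner_eq_zero_symm.1 h)
    · exact hb j h
  · intro l _ hl
    rw [inner_eq_zero_symm.1 (hother l hl), zero_mul]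
  · simp

theorem lieSpan_compression_eq_top {ι : Type*} [Fintype ι] (K : Submodule ℂ E) {v : E}
    (hv : Kᗮ = ℂ ∙ v) (b : OrthonormalBasis ι ℂ E) (hb : ∀ j, inner ℂ (b j) v ≠ 0) {x : ι → ℝ}
    (hx : Function.Injective x) {H : Module.End ℂ E} (hH : IsSelfAdjoint H)
    (hHb : ∀ j, H (b j) = (x j : ℂ) • b j) (i : ι) :
    LieSubalgebra.lieSpan ℂ (Module.End ℂ K) {compression K H, compression K (ketBra (b i) (b i))}
      = ⊤ := by
  rw [compression_ketBra]
  exact lieSpan_ketBra_eq_top (isSelfAdjoint_compression K hH)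
    (eq_zero_of_forall_inner_pow_compression K hv b hb hx hH hHb i)

end

/-! ### Generation as a determinant condition -/

section
variable {ι : Type*} [Fintype ι] [DecidableEq ι]

/-- The square matrix whose rows are the entries of the iterated brackets of `A` and `B` along a
family of trees. -/
def bracketTreeMatrix {R : Type*} [CommRing R] (A B : Matrix ι ι R)
    (t : ι × ι → FreeMagma Bool) : Matrix (ι × ι) (ι × ι) R :=
  Matrix.of fun p q => bracketTree A B (t p) q.1 q.2

theorem exists_det_bracketTreeMatrix_ne_zero_iff (A B : Matrix ι ι ℂ) :
    (∃ t, (bracketTreeMatrix A B t).det ≠ 0) ↔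
      LieSubalgebra.lieSpan ℂ (Matrix ι ι ℂ) {A, B} = ⊤ := by
  have key (t : ι × ι → FreeMagma Bool) : (bracketTreeMatrix A B t).det ≠ 0 ↔
      LinearIndependent ℂ fun p => bracketTree A B (t p) := by
    rw [← isUnit_iff_ne_zero, ← Matrix.isUnit_iff_isUnit_det,
      ← Matrix.linearIndependent_rows_iff_isUnit]
    exact LinearMap.linearIndependent_iff_of_injOn
      (LinearEquiv.curry ℂ ℂ ι ι).symm.toLinearMap (LinearEquiv.injective _).injOn
  have hcard : Fintype.card (ι × ι) = Module.finrank ℂ (Matrix ι ι ℂ) := by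
    rw [Module.finrank_matrix]
    simp
  rw [lieSpan_pair_eq_top_iff]
  constructor
  · rintro ⟨t, ht⟩
    rw [key] at ht
    have h := ht.span_eq_top_of_card_eq_finrank' hcard
    rw [eq_top_iff, ← h]
    refine Submodule.span_mono ?_
    rintro _ ⟨p, rfl⟩
    exact ⟨t p, rfl⟩
  · intro h
    obtain ⟨κ, a, ha, hspan, hli⟩ := exists_linearIndependent' ℂ (bracketTree A B)
    rw [h] at hspan
    let b := Module.Basis.mk hli hspan.ge
    -- A basis extracted from the brackets has as many elements as the matrix units, so it can be
    -- indexed by `ι × ι`.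
    let c := (Matrix.stdBasis ℂ ι ι).indexEquiv b
    refine ⟨fun p => a (c p), (key _).2 ?_⟩
    exact hli.comp c c.injective

theorem isOpen_setOf_lieSpan_pair_eq_top {X : Type*} [TopologicalSpace X]
    {A B : X → Matrix ι ι ℂ} (hA : Continuous A) (hB : Continuous B) :
    IsOpen {z | LieSubalgebra.lieSpan ℂ (Matrix ι ι ℂ) {A z, B z} = ⊤} := by
  have hc (t : FreeMagma Bool) : Continuous fun z => bracketTree (A z) (B z) t := by
    induction t with
    | ih1 i => cases i <;> simpa [bracketTree]
    | ih2 s t hs ht => exact (hs.mul ht).sub (ht.mul hs)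
  simp_rw [← exists_det_bracketTreeMatrix_ne_zero_iff, Set.ofPred_exists]
  refine isOpen_iUnion fun t => isOpen_ne_fun (Continuous.matrix_det ?_) continuous_const
  exact continuous_matrix fun p q => (hc (t p)).matrix_elem _ _

/-- A bracket determinant that is nonzero at `t = 0` is a nonzero polynomial in `t`; failure can
occur only at its roots. -/
theorem finite_setOf_lieSpan_pair_ne_top (A A' B B' : Matrix ι ι ℂ)
    (h : LieSubalgebra.lieSpan ℂ (Matrix ι ι ℂ) {A, B} = ⊤) :
    {t : ℂ | LieSubalgebra.lieSpan ℂ (Matrix ι ι ℂ) {A + t • A', B + t • B'} ≠ ⊤}.Finite := by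
  obtain ⟨T, hT⟩ := (exists_det_bracketTreeMatrix_ne_zero_iff A B).2 h
  let line (A A' : Matrix ι ι ℂ) : Matrix ι ι (Polynomial ℂ) :=
    A.map Polynomial.C + (Polynomial.X : Polynomial ℂ) • A'.map Polynomial.C
  have hline (t : ℂ) (A A' : Matrix ι ι ℂ) :
      (Polynomial.evalRingHom t).mapMatrix (line A A') = A + t • A' := by
    ext i j
    simp [line]
    ring
  let p := (bracketTreeMatrix (line A A') (line B B') T).det
  have hp (t : ℂ) : p.eval t = (bracketTreeMatrix (A + t • A') (B + t • B') T).det := by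
    rw [← Polynomial.coe_evalRingHom, RingHom.map_det]
    congr 1
    ext i j
    have := map_bracketTree (Polynomial.evalRingHom t).mapMatrix (fun x y => by
      change _ = _ * _ - _ * _
      rw [← map_mul, ← map_mul, ← map_sub]
      rfl) (line A A') (line B B') (T i)
    rw [hline, hline] at this
    exact congrFun (congrFun this j.1) j.2
  have hp0 : p ≠ 0 := by
    intro h0
    have := hp 0
    rw [h0] at this
    simp only [Polynomial.eval_zero, zero_smul, add_zero] at this
    exact hT this.symm
  refine (Polynomial.finite_setOfPred_isRoot hp0).subset fun t ht => ?_
  by_contra hroot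
  refine ht ((exists_det_bracketTreeMatrix_ne_zero_iff _ _).1 ⟨T, ?_⟩)
  rw [← hp]
  exact hroot

end

/-! ### Null sets -/

/-- By Fubini in `(e, t)`, for almost every `t` the set of `e` with `z + t e ∈ Z` is null. One such
`t ≠ 0` suffices, as this set is a translated and rescaled copy of `Z`. -/
theorem addHaar_eq_zero_of_forall_line {F : Type*} [NormedAddCommGroup F] [NormedSpace ℝ F]
    [FiniteDimensional ℝ F] [MeasurableSpace F] [BorelSpace F] (μ : Measure F) [μ.IsAddHaarMeasure]
    {Z : Set F} (hZ : IsClosed Z) (z : F)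
    (h : ∀ e : F, volume {t : ℝ | z + t • e ∈ Z} = 0) : μ Z = 0 := by
  have hcl : IsClosed {p : F × ℝ | z + p.2 • p.1 ∈ Z} :=
    hZ.preimage (continuous_const.add (continuous_snd.smul continuous_fst))
  have h1 : (μ.prod volume) {p : F × ℝ | z + p.2 • p.1 ∈ Z} = 0 :=
    (Measure.measure_prod_null hcl.measurableSet).2 (Filter.Eventually.of_forall h)
  rw [← Measure.prod_swap, Measure.map_apply measurable_swap hcl.measurableSet] at h1
  have h2 := Measure.measure_ae_null_of_prod_null h1
  have h3 : ∀ᵐ t : ℝ, t ≠ 0 := by simp [ae_iff]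
  obtain ⟨t, ht, ht0⟩ := (h2.and h3).exists
  have h4 : {e : F | z + t • e ∈ Z} = (t • ·) ⁻¹' ((z + ·) ⁻¹' Z) := rfl
  change μ {e : F | z + t • e ∈ Z} = 0 at ht
  rw [h4, Measure.addHaar_preimage_smul μ ht0, measure_preimage_add, mul_eq_zero] at ht
  refine ht.resolve_left ?_
  simp [ht0]

/-! ### Columns of a Haar-random unitary -/

theorem exists_linearIsometry_apply_eq {E : Type*} [NormedAddCommGroup E] [InnerProductSpace ℂ E]
    [FiniteDimensional ℂ E] {v w : E} (h : ‖v‖ = ‖w‖) :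
    ∃ f : E →ₗᵢ[ℂ] E, f v = w := by
  by_cases hv : v = 0
  · refine ⟨LinearIsometry.id, ?_⟩
    rw [hv, norm_zero, eq_comm, norm_eq_zero] at h
    simp [hv, h]
  let e := LinearEquiv.toSpanNonzeroSingleton ℂ E v hv
  let L : (ℂ ∙ v) →ₗᵢ[ℂ] E :=
    { LinearMap.toSpanSingleton ℂ E w ∘ₗ e.symm.toLinearMap with
      norm_map' := by
        intro x
        obtain ⟨c, rfl⟩ := e.surjective x
        rw [LinearMap.comp_apply, LinearEquiv.coe_coe, e.symm_apply_apply]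
        simp [e, norm_smul, h] }
  refine ⟨L.extend, ?_⟩
  have := L.extend_apply ⟨v, Submodule.mem_span_singleton_self v⟩
  rw [this]
  have h1 : (⟨v, Submodule.mem_span_singleton_self v⟩ : ℂ ∙ v) = e 1 := by
    ext; simp [e]
  change LinearMap.toSpanSingleton ℂ E w (e.symm _) = w
  rw [h1, e.symm_apply_apply]
  simp

theorem exists_unitaryGroup_toEuclideanLin_eq {n : ℕ} {v w : EuclideanSpace ℂ (Fin n)}
    (h : ‖v‖ = ‖w‖) : ∃ g : Matrix.unitaryGroup (Fin n) ℂ,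
      Matrix.toEuclideanLin (g : Matrix (Fin n) (Fin n) ℂ) v = w := by
  obtain ⟨f, hf⟩ := exists_linearIsometry_apply_eq h
  let M := Matrix.toEuclideanLin.symm f.toLinearMap
  have hM : Matrix.toEuclideanLin M = f.toLinearMap := LinearEquiv.apply_symm_apply _ _
  refine ⟨⟨M, ?_⟩, ?_⟩
  · rw [Matrix.mem_unitaryGroup_iff']
    apply Matrix.toEuclideanLin.injective
    rw [Matrix.star_eq_conjTranspose, Matrix.toLpLin_mul_same,
      Matrix.toEuclideanLin_conjTranspose_eq_adjoint, hM]
    ext1 x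
    refine ext_inner_left ℂ fun y => ?_
    rw [LinearMap.comp_apply, LinearMap.adjoint_inner_right]
    simp
  · rw [hM]
    exact hf

/-- The image of the standard basis vector `e i` under the unitary matrix `U`. -/
noncomputable def unitaryColumn {n : ℕ} (U : Matrix.unitaryGroup (Fin n) ℂ) (i : Fin n) :
    EuclideanSpace ℂ (Fin n) :=
  Matrix.toEuclideanLin (U : Matrix (Fin n) (Fin n) ℂ) (EuclideanSpace.single i 1)

theorem inner_toEuclideanLin_unitary {n : ℕ} (U : Matrix.unitaryGroup (Fin n) ℂ)
    (x y : EuclideanSpace ℂ (Fin n)) :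
    inner ℂ (Matrix.toEuclideanLin (U : Matrix (Fin n) (Fin n) ℂ) x)
      (Matrix.toEuclideanLin (U : Matrix (Fin n) (Fin n) ℂ) y) = inner ℂ x y := by
  rw [← LinearMap.adjoint_inner_right, ← Matrix.toEuclideanLin_conjTranspose_eq_adjoint,
    ← LinearMap.comp_apply, ← Matrix.toLpLin_mul_same,
    ← Matrix.star_eq_conjTranspose, (Matrix.mem_unitaryGroup_iff').1 U.2]
  simp

theorem orthonormal_unitaryColumn {n : ℕ} (U : Matrix.unitaryGroup (Fin n) ℂ) :
    Orthonormal ℂ (unitaryColumn U) := by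
  rw [orthonormal_iff_ite]
  intro i j
  rw [unitaryColumn, unitaryColumn, inner_toEuclideanLin_unitary]
  exact orthonormal_iff_ite.1 (EuclideanSpace.orthonormal_single) i j

/-- The columns of a unitary matrix form an orthonormal basis. -/
noncomputable def unitaryColumnBasis {n : ℕ} (U : Matrix.unitaryGroup (Fin n) ℂ) :
    OrthonormalBasis (Fin n) ℂ (EuclideanSpace ℂ (Fin n)) :=
  OrthonormalBasis.mk (orthonormal_unitaryColumn U)
    ((orthonormal_unitaryColumn U).linearIndependent.span_eq_top_of_card_eq_finrank'
      (by simp)).ge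

@[simp] theorem unitaryColumnBasis_apply {n : ℕ} (U : Matrix.unitaryGroup (Fin n) ℂ) (i : Fin n) :
    unitaryColumnBasis U i = unitaryColumn U i := by
  simp [unitaryColumnBasis]

theorem continuous_unitaryColumn {n : ℕ} (i : Fin n) :
    Continuous fun U : Matrix.unitaryGroup (Fin n) ℂ => unitaryColumn U i := by
  have : Continuous fun M : Matrix (Fin n) (Fin n) ℂ =>
      Matrix.toEuclideanLin M (EuclideanSpace.single i 1) :=
    ((LinearMap.applyₗ (EuclideanSpace.single i (1 : ℂ))).comp
      (Matrix.toEuclideanLin (𝕜 := ℂ) (m := Fin n) (n := Fin n)).toLinearMap).continuous_of_finiteDimensional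
  exact this.comp continuous_subtype_val

theorem unitaryColumn_mul {n : ℕ} (g U : Matrix.unitaryGroup (Fin n) ℂ) (i : Fin n) :
    unitaryColumn (g * U) i =
      Matrix.toEuclideanLin (g : Matrix (Fin n) (Fin n) ℂ) (unitaryColumn U i) := by
  rw [unitaryColumn, Matrix.UnitaryGroup.mul_val, Matrix.toLpLin_mul_same]
  rfl

/-- For fixed `U` the vectors orthogonal to the column form a proper subspace, which is null. Fubini
yields some `w ≠ 0` for which the bad `U` are null; a unitary taking `v` to a multiple of `w` and
invariance of Haar measure transfer this to `v`. -/
theorem haar_setOf_inner_unitaryColumn_eq_zero {n : ℕ} {v : EuclideanSpace ℂ (Fin n)} (hv : v ≠ 0)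
    (i : Fin n) : (Measure.haar : Measure (Matrix.unitaryGroup (Fin n) ℂ))
      {U | inner ℂ (unitaryColumn U i) v = 0} = 0 := by
  set μ := (Measure.haar : Measure (Matrix.unitaryGroup (Fin n) ℂ))
  have hcl : IsClosed {p : Matrix.unitaryGroup (Fin n) ℂ × EuclideanSpace ℂ (Fin n) |
      inner ℂ (unitaryColumn p.1 i) p.2 = 0} :=
    isClosed_eq (((continuous_unitaryColumn i).comp continuous_fst).inner continuous_snd)
      continuous_const
  have h1 : (μ.prod volume) {p : Matrix.unitaryGroup (Fin n) ℂ × EuclideanSpace ℂ (Fin n) |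
      inner ℂ (unitaryColumn p.1 i) p.2 = 0} = 0 := by
    refine (Measure.measure_prod_null hcl.measurableSet).2 (Filter.Eventually.of_forall fun U => ?_)
    have := Measure.addHaar_submodule (volume : Measure (EuclideanSpace ℂ (Fin n)))
      ((ℂ ∙ unitaryColumn U i)ᗮ.restrictScalars ℝ) (by
        intro htop
        have : unitaryColumn U i ∈ (ℂ ∙ unitaryColumn U i)ᗮ.restrictScalars ℝ :=
          htop ▸ Submodule.mem_top
        rw [Submodule.restrictScalars_mem, Submodule.mem_orthogonal_singleton_iff_inner_right,
          unitaryColumn, inner_toEuclideanLin_unitary] at this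
        simp at this)
    refine Eq.trans (congrArg volume ?_) this
    ext w
    exact Submodule.mem_orthogonal_singleton_iff_inner_right.symm
  rw [← Measure.prod_swap, Measure.map_apply measurable_swap hcl.measurableSet] at h1
  have h2 := Measure.measure_ae_null_of_prod_null h1
  have : Nontrivial (EuclideanSpace ℂ (Fin n)) := ⟨v, 0, hv⟩
  have h3 : ∀ᵐ w : EuclideanSpace ℂ (Fin n), w ≠ 0 := by simp [ae_iff]
  obtain ⟨w, hw, hw0⟩ := (h2.and h3).exists
  change μ {U | inner ℂ (unitaryColumn U i) w = 0} = 0 at hw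
  obtain ⟨g, hg⟩ := exists_unitaryGroup_toEuclideanLin_eq
    (v := v) (w := ((‖v‖ / ‖w‖ : ℝ) : ℂ) • w) (by
      rw [norm_smul, Complex.norm_real, Real.norm_eq_abs, abs_of_nonneg (by positivity),
        div_mul_cancel₀ _ (norm_ne_zero_iff.2 hw0)])
  rw [← measure_preimage_mul μ g] at hw
  convert hw using 2
  ext U
  have hne : ((‖v‖ / ‖w‖ : ℝ) : ℂ) ≠ 0 := by
    simp [hv, hw0]
  change inner ℂ (unitaryColumn U i) v = 0 ↔ inner ℂ (unitaryColumn (g * U) i) w = 0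
  rw [unitaryColumn_mul, ← inner_toEuclideanLin_unitary g, hg, inner_smul_right, mul_eq_zero,
    or_iff_right hne]

/-! ### Compressions in matrix form -/

theorem lieSpan_pair_map_eq_top_iff {R S T : Type*} [CommRing R] [Ring S] [Ring T] [Algebra R S]
    [Algebra R T] (e : S ≃ₐ[R] T) (a b : S) :
    LieSubalgebra.lieSpan R T {e a, e b} = ⊤ ↔ LieSubalgebra.lieSpan R S {a, b} = ⊤ := by
  rw [lieSpan_pair_eq_top_iff, lieSpan_pair_eq_top_iff]
  have h : bracketTree (e a) (e b) = e.toLinearEquiv ∘ bracketTree a b := by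
    funext t
    refine (map_bracketTree e (fun x y => ?_) a b t).symm
    change e (x * y - y * x) = e x * e y - e y * e x
    rw [map_sub, map_mul, map_mul]
  rw [h, Set.range_comp]
  change Submodule.span R (e.toLinearEquiv.toLinearMap '' _) = ⊤ ↔ _
  rw [Submodule.span_image]
  exact Submodule.map_eq_top_iff (e := e.toLinearEquiv)

theorem diagonalized_unitaryColumn {n : ℕ} (U : Matrix.unitaryGroup (Fin n) ℂ) (x : Fin n → ℝ)
    (j : Fin n) : diagonalized U x (unitaryColumn U j) = (x j : ℂ) • unitaryColumn U j := by
  rw [diagonalized, unitaryColumn, ← LinearMap.comp_apply, ← Matrix.toLpLin_mul_same,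
    Matrix.mul_assoc, ← Matrix.star_eq_conjTranspose, (Matrix.mem_unitaryGroup_iff').1 U.2,
    Matrix.mul_one, Matrix.toLpLin_mul_same, LinearMap.comp_apply, ← map_smul]
  congr 1
  ext k
  by_cases h : k = j <;> simp [Matrix.toLpLin_apply, h]

theorem diagonalized_single {n : ℕ} (U : Matrix.unitaryGroup (Fin n) ℂ) (i : Fin n) :
    diagonalized U (Pi.single i 1) = ketBra (unitaryColumn U i) (unitaryColumn U i) := by
  refine (unitaryColumnBasis U).toBasis.ext fun j => ?_
  rw [OrthonormalBasis.coe_toBasis, unitaryColumnBasis_apply, diagonalized_unitaryColumn,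
    ketBra_apply, orthonormal_iff_ite.1 (orthonormal_unitaryColumn U)]
  by_cases h : i = j
  · subst h; simp
  · simp [h, Ne.symm h]

/-- The compression of the operator with matrix `M` to `K`, as a matrix with respect to an
orthonormal basis of `K`. -/
noncomputable def compressionMatrix {n : ℕ} (K : Submodule ℂ (EuclideanSpace ℂ (Fin n))) :
    Matrix (Fin n) (Fin n) ℂ →ₗ[ℂ]
      Matrix (Fin (Module.finrank ℂ K)) (Fin (Module.finrank ℂ K)) ℂ where
  toFun M := LinearMap.toMatrixAlgEquiv (stdOrthonormalBasis ℂ K).toBasis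
    (compression K (Matrix.toEuclideanLin M))
  map_add' M N := by
    rw [← map_add]
    congr 1
    simp only [compression, map_add, LinearMap.add_comp, LinearMap.comp_add]
  map_smul' c M := by
    rw [RingHom.id_apply, ← map_smul]
    congr 1
    simp only [compression, map_smul, LinearMap.smul_comp, LinearMap.comp_smul]

/-- The matrix of the compression of `U diag(x) U†` to `K`. -/
noncomputable def compressedMatrix {n : ℕ} (K : Submodule ℂ (EuclideanSpace ℂ (Fin n)))
    (U : Matrix.unitaryGroup (Fin n) ℂ) (x : Fin n → ℝ) :
    Matrix (Fin (Module.finrank ℂ K)) (Fin (Module.finrank ℂ K)) ℂ :=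
  compressionMatrix K ((U : Matrix (Fin n) (Fin n) ℂ) * diagonal (fun i => (x i : ℂ)) *
      (U : Matrix (Fin n) (Fin n) ℂ)ᴴ)

theorem lieSpan_compressedMatrix_eq_top_iff {n : ℕ} (K : Submodule ℂ (EuclideanSpace ℂ (Fin n)))
    (U : Matrix.unitaryGroup (Fin n) ℂ) (x y : Fin n → ℝ) :
    LieSubalgebra.lieSpan ℂ _ {compressedMatrix K U x, compressedMatrix K U y} = ⊤ ↔
      LieSubalgebra.lieSpan ℂ (Module.End ℂ K)
        {compression K (diagonalized U x), compression K (diagonalized U y)} = ⊤ :=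
  lieSpan_pair_map_eq_top_iff (LinearMap.toMatrixAlgEquiv (stdOrthonormalBasis ℂ K).toBasis) _ _

theorem continuous_compressedMatrix {n : ℕ} (K : Submodule ℂ (EuclideanSpace ℂ (Fin n)))
    {X : Type*} [TopologicalSpace X] {U : X → Matrix.unitaryGroup (Fin n) ℂ} {x : X → Fin n → ℝ}
    (hU : Continuous U) (hx : Continuous x) :
    Continuous fun z => compressedMatrix K (U z) (x z) := by
  have h1 : Continuous fun z => (U z : Matrix (Fin n) (Fin n) ℂ) := continuous_subtype_val.comp hU
  have h2 : Continuous fun z => diagonal (fun i => (x z i : ℂ)) := by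
    apply Continuous.matrix_diagonal
    fun_prop
  exact (compressionMatrix K).continuous_of_finiteDimensional.comp
    ((h1.mul h2).mul h1.matrix_conjTranspose)

theorem compressedMatrix_add_smul {n : ℕ} (K : Submodule ℂ (EuclideanSpace ℂ (Fin n)))
    (U : Matrix.unitaryGroup (Fin n) ℂ) (x y : Fin n → ℝ) (t : ℝ) :
    compressedMatrix K U (x + t • y) = compressedMatrix K U x + (t : ℂ) • compressedMatrix K U y := by
  have h : diagonal (fun i => (((x + t • y) i : ℝ) : ℂ)) =
      diagonal (fun i => (x i : ℂ)) + (t : ℂ) • diagonal (fun i => (y i : ℂ)) := by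
    ext i j
    by_cases hij : i = j <;> simp [hij]
  rw [compressedMatrix, h, Matrix.mul_add, Matrix.add_mul, map_add, Matrix.mul_smul,
    Matrix.smul_mul, map_smul]
  rfl

/-! ### Almost every commuting pair generates -/

theorem ae_lieSpan_compression_eq_top {n : ℕ} (hn : n ≠ 0)
    (K : Submodule ℂ (EuclideanSpace ℂ (Fin n))) {v : EuclideanSpace ℂ (Fin n)} (hv0 : v ≠ 0)
    (hv : Kᗮ = ℂ ∙ v) : ∀ᵐ q ∂parameterMeasure n,
      LieSubalgebra.lieSpan ℂ (Module.End ℂ K)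
        {compression K (diagonalized q.1 q.2.1), compression K (diagonalized q.1 q.2.2)} = ⊤ := by
  simp_rw [← lieSpan_compressedMatrix_eq_top_iff]
  -- Openness supplies the measurability needed to work with one `U` at a time.
  have hopen := isOpen_setOf_lieSpan_pair_eq_top
    (continuous_compressedMatrix K
      (continuous_fst (X := Matrix.unitaryGroup (Fin n) ℂ) (Y := (Fin n → ℝ) × (Fin n → ℝ)))
      continuous_snd.fst)
    (continuous_compressedMatrix K continuous_fst continuous_snd.snd)
  have hcol : ∀ᵐ U ∂(Measure.haar : Measure (Matrix.unitaryGroup (Fin n) ℂ)),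
      ∀ i, inner ℂ (unitaryColumn U i) v ≠ 0 := by
    rw [ae_all_iff]
    intro i
    rw [ae_iff]
    simpa using haar_setOf_inner_unitaryColumn_eq_zero hv0 i
  rw [ae_iff, ← Set.compl_ofPred, parameterMeasure,
    Measure.measure_prod_null hopen.isClosed_compl.measurableSet]
  filter_upwards [hcol] with U hU
  -- The good pair: distinct eigenvalues `0, …, n - 1`, and the projection onto the first column.
  let x : Fin n → ℝ := fun i => (i : ℕ)
  let y : Fin n → ℝ := Pi.single ⟨0, Nat.pos_of_ne_zero hn⟩ 1
  have hwit : LieSubalgebra.lieSpan ℂ _ {compressedMatrix K U x, compressedMatrix K U y} = ⊤ := by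
    rw [lieSpan_compressedMatrix_eq_top_iff, diagonalized_single]
    have := lieSpan_compression_eq_top K hv (unitaryColumnBasis U) (by simpa using hU) (x := x)
      (fun i j h => Fin.ext (by simpa [x] using h)) (isSelfAdjoint_diagonalized U x)
      (by simpa using diagonalized_unitaryColumn U x) ⟨0, Nat.pos_of_ne_zero hn⟩
    simpa using this
  have : (volume : Measure ((Fin n → ℝ) × (Fin n → ℝ))).IsAddHaarMeasure :=
    Measure.prod.instIsAddHaarMeasure _ _
  refine addHaar_eq_zero_of_forall_line (volume : Measure ((Fin n → ℝ) × (Fin n → ℝ)))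
    (hopen.isClosed_compl.preimage (Continuous.prodMk_right U)) (x, y) fun e => ?_
  have hfin := (finite_setOf_lieSpan_pair_ne_top _ (compressedMatrix K U e.1) _
    (compressedMatrix K U e.2) hwit).preimage (Complex.ofReal_injective.injOn)
  refine Set.Finite.measure_zero (hfin.subset fun t ht => ?_) _
  change ¬ (LieSubalgebra.lieSpan ℂ _
    {compressedMatrix K U (x + t • e.1), compressedMatrix K U (y + t • e.2)} = ⊤) at ht
  rwa [compressedMatrix_add_smul, compressedMatrix_add_smul] at ht

theorem eventually_lieGenerated_eq_unitaryLieAlgebra (d : ℕ)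
    (K : Submodule ℂ (EuclideanSpace ℂ (Fin (d + 1)))) (hK : Module.finrank ℂ K = d) :
    ∀ᶠ p in almostAllCommutingPairs (d + 1),
      lieGenerated (E := K) ![compression K p.1.1, compression K p.1.2] = unitaryLieAlgebra K := by
  have hfin : Module.finrank ℂ Kᗮ = 1 := by
    have := K.finrank_add_finrank_orthogonal
    rw [hK, finrank_euclideanSpace, Fintype.card_fin] at this
    omega
  obtain ⟨v, hv0, hv⟩ := finrank_eq_one_iff'.1 hfin
  have hspan : Kᗮ = ℂ ∙ (v : EuclideanSpace ℂ (Fin (d + 1))) := by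
    refine le_antisymm (fun w hw => ?_) ((Submodule.span_singleton_le_iff_mem _ _).2 v.2)
    obtain ⟨c, hc⟩ := hv ⟨w, hw⟩
    exact Submodule.mem_span_singleton.2 ⟨c, congrArg Subtype.val hc⟩
  rw [almostAllCommutingPairs, Filter.eventually_map]
  filter_upwards [ae_lieSpan_compression_eq_top d.succ_ne_zero K
    (fun h => hv0 (Subtype.ext h)) hspan] with q hq
  exact lieGenerated_pair_eq_unitaryLieAlgebra
    (isSelfAdjoint_compression K (isSelfAdjoint_diagonalized _ _))
    (isSelfAdjoint_compression K (isSelfAdjoint_diagonalized _ _)) hq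

theorem exists_isMaximalCommutative_mem {E : Type*} [NormedAddCommGroup E] [InnerProductSpace ℂ E]
    [FiniteDimensional ℂ E] {H₁ H₂ : Module.End ℂ E} (h₁ : IsSelfAdjoint H₁)
    (h₂ : IsSelfAdjoint H₂) (h : Commute H₁ H₂) :
    ∃ A : LieSubalgebra ℝ (Module.End ℂ E), IsMaximalCommutative A ∧
      Complex.I • H₁ ∈ A ∧ Complex.I • H₂ ∈ A := by
  have hcomm {a b : Module.End ℂ E} (hab : Commute a b) : ⁅a, b⁆ = 0 := sub_eq_zero.2 hab
  have hlie : ∀ a ∈ Submodule.span ℝ {Complex.I • H₁, Complex.I • H₂},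
      ∀ b ∈ Submodule.span ℝ {Complex.I • H₁, Complex.I • H₂}, ⁅a, b⁆ = 0 := by
    intro a ha b hb
    rw [Submodule.mem_span_pair] at ha hb
    obtain ⟨r, s, rfl⟩ := ha
    obtain ⟨r', s', rfl⟩ := hb
    simp only [lie_add, add_lie, lie_smul, smul_lie, lie_self, hcomm h, hcomm h.symm, smul_zero,
      add_zero]
  let B : LieSubalgebra ℝ (Module.End ℂ E) :=
    { Submodule.span ℝ {Complex.I • H₁, Complex.I • H₂} with
      lie_mem' := fun {a b} ha hb => by
        rw [hlie a ha b hb]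
        exact zero_mem (Submodule.span ℝ {Complex.I • H₁, Complex.I • H₂}) }
  have hB : B ≤ unitaryLieAlgebra E ∧ IsLieAbelian B := by
    constructor
    · change Submodule.span ℝ {Complex.I • H₁, Complex.I • H₂} ≤ (unitaryLieAlgebra E).toSubmodule
      rw [Submodule.span_le]
      rintro _ (rfl | rfl)
      · exact I_smul_mem_unitaryLieAlgebra h₁
      · exact I_smul_mem_unitaryLieAlgebra h₂
    · exact ⟨fun a b => Subtype.ext (hlie a a.2 b b.2)⟩
  obtain ⟨A, hBA, hA⟩ := exists_maximal_ge_of_wellFoundedGT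
    (fun B : LieSubalgebra ℝ (Module.End ℂ E) => B ≤ unitaryLieAlgebra E ∧ IsLieAbelian B) B hB
  exact ⟨A, hA, hBA (Submodule.subset_span (by simp)), hBA (Submodule.subset_span (by simp))⟩

theorem theorem5 (d : ℕ) (K : Submodule ℂ (EuclideanSpace ℂ (Fin (d + 1))))
    (hK : Module.finrank ℂ K = d) :
    (∀ᶠ p in almostAllCommutingPairs (d + 1),
      lieGenerated (E := K) ![compression K p.1.1, compression K p.1.2] = unitaryLieAlgebra K) ∧
    (∃ A : LieSubalgebra ℝ (Module.End ℂ (EuclideanSpace ℂ (Fin (d + 1)))),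
      IsMaximalCommutative A ∧ IsGeneratorPurification K A (unitaryLieAlgebra K)) := by
  have hae := eventually_lieGenerated_eq_unitaryLieAlgebra d K hK
  refine ⟨hae, ?_⟩
  -- Positivity on nonempty open sets makes the measure nonzero, so an almost sure property holds
  -- for some pair.
  have : (parameterMeasure (d + 1)).IsOpenPosMeasure := by
    unfold parameterMeasure
    infer_instance
  have : (almostAllCommutingPairs (d + 1)).NeBot := Filter.map_neBot
  obtain ⟨⟨⟨H₁, H₂⟩, h₁, h₂, h⟩, hgen⟩ := hae.exists
  obtain ⟨A, hA, hA₁, hA₂⟩ := exists_isMaximalCommutative_mem h₁ h₂ h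
  refine ⟨A, hA, hA.prop.1, hA.prop.2, 2, ![compression K H₁, compression K H₂], ![H₁, H₂],
    ⟨?_, ?_, ?_, ?_⟩, ?_, hgen⟩
  · exact Fin.forall_fin_two.2 ⟨isSelfAdjoint_compression K h₁, isSelfAdjoint_compression K h₂⟩
  · exact Fin.forall_fin_two.2 ⟨h₁, h₂⟩
  · exact Fin.forall_fin_two.2 ⟨Fin.forall_fin_two.2 ⟨Commute.refl _, h⟩,
      Fin.forall_fin_two.2 ⟨h.symm, Commute.refl _⟩⟩
  · exact Fin.forall_fin_two.2 ⟨rfl, rfl⟩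
  · exact Fin.forall_fin_two.2 ⟨hA₁, hA₂⟩
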